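/- **Definitions.** Let $\alpha=(\alpha_1,\dots,\alpha_s)$ be a finite sequence of positive integers with sum $n-1$. The fence $F(\alpha)$ is the poset on $x_1,\dots,x_n$ with covering relations $$x_1\lhd x_2\lhd\cdots\lhd x_{\alpha_1+1}\rhd x_{\alpha_1+2}\rhd\cdots\rhd x_{\alpha_1+\alpha_2+1}\lhd x_{\alpha_1+\alpha_2+2}\lhd\cdots,$$ going up along the first $\alpha_1$ steps, down along the next $\alpha_2$ steps, up along the next $\alpha_3$ steps, and so on. Let $L(\alpha)$ be the lattice of lower order ideals of $F(\alpha)$ ordered by inclusion. It is ranked, with $\operatorname{rk} I=\#I$ and $\operatorname{rk}L(\alpha)=n$. Let $r(\alpha)=(r_0,\dots,r_n)$, where $r_k$ is the number of elements of $L(\alpha)$ of rank $k$. A chain decomposition of $L(\alpha)$ is a set partition of $L(\alpha)$ into saturated chains. The center of a saturated chain with minimum $x$ and maximum $y$ is $(\operatorname{rk}x+\operatorname{rk}y)/2$. A chain decomposition is *symmetric* if all its chains have center $n/2$, *top centered* if each of its chains has center $n/2$ or $(n+1)/2$, and *bottom centered* if each of its chains has center $n/2$ or $(n-1)/2$. A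 sequence $a_0,\dots,a_n$ is *symmetric* if $a_k=a_{n-k}$ for all $k<n/2$, *top interlacing* if $a_0\le a_n\le a_1\le a_{n-1}\le\cdots\le a_{\lceil n/2\rceil}$, and *bottom interlacing* if $a_n\le a_0\le a_{n-1}\le a_1\le\cdots\le a_{\lfloor n/2\rfloor}$. **Theorem.** Suppose that $\alpha$ has at most three parts, i.e. $s\le 3$. 1. If $s=1$, then $L(\alpha)$ has a symmetric chain decomposition, and $r(\alpha)=(1,1,\dots,1)$, which is symmetric. 2. If $s$ is even ($s=2$, or the trivial case $s=0$ in which $F(\alpha)$ has one element), then $L(\alpha)$ has a bottom centered chain decomposition, and $r(\alpha)$ is bottom interlacing. 3. If $s=3$ and $\alpha=(a,b,c)$, then - if $a>c$, $L(\alpha)$ has a bottom centered chain decomposition, and $r(\alpha)$ is bottom interlacing; - if $a<c$, $L(\alpha)$ has a top centered chain decomposition, and $r(\alpha)$ is top interlacing; - if $a=c$, $L(\alpha)$ has a symmetric chain decomposition, and $r(\alpha)$ is symmetric. -/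

import Mathlib

namespace FenceLattice

/-! ### Fences and their lattices of ideals -/

/-- The index (starting at `0`) of the segment that contains the step from the `i`-th to the
`(i+1)`-st element of the fence (elements are numbered from `0`).  The first `a` steps belong to
segment `0`, the next `b` steps to segment `1`, and so on, where `α = (a, b, …)`. -/
def segment : List ℕ → ℕ → ℕ
  | [], _ => 0
  | a :: α, i => if i < a then 0 else segment α (i - a) + 1

/-- The underlying set of the fence `F(α)`: its elements are `x₀, x₁, …, xₘ`, where
`m = α₁ + ⋯ + αₛ`. -/
def Fence (α : List ℕ) : Type := Fin (α.sum + 1)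

instance (α : List ℕ) : Fintype (Fence α) := inferInstanceAs (Fintype (Fin (α.sum + 1)))

instance (α : List ℕ) : DecidableEq (Fence α) := inferInstanceAs (DecidableEq (Fin (α.sum + 1)))

/-- The position of an element of the fence, from left to right. -/
def Fence.pos {α : List ℕ} (x : Fence α) : ℕ := Fin.val (n := α.sum + 1) x

/-- The covering relations of the fence: consecutive elements are comparable, going up from left
to right on the first, third, fifth, … segment, and down on the second, fourth, … one. -/
def Fence.Cov {α : List ℕ} (x y : Fence α) : Prop :=
  (y.pos = x.pos + 1 ∧ Even (segment α x.pos)) ∨ (x.pos = y.pos + 1 ∧ ¬ Even (segment α y.pos))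

/-- Explicit form of the order generated by the covering relations. -/
theorem Fence.reflTransGen_cov {α : List ℕ} {x y : Fence α}
    (h : Relation.ReflTransGen Fence.Cov x y) :
    (x.pos ≤ y.pos ∧ ∀ i, x.pos ≤ i → i < y.pos → Even (segment α i)) ∨
      (y.pos ≤ x.pos ∧ ∀ i, y.pos ≤ i → i < x.pos → ¬ Even (segment α i)) := by
  induction h with
  | refl => exact Or.inl ⟨le_rfl, fun i h1 h2 => absurd h2 (by omega)⟩
  | @tail b c _ hbc ih =>
    rcases hbc with ⟨h1, h2⟩ | ⟨h1, h2⟩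
    · rcases ih with ⟨h3, h4⟩ | ⟨h3, h4⟩
      · refine Or.inl ⟨by omega, fun i hi hi' => ?_⟩
        rcases Nat.lt_or_ge i b.pos with h | h
        · exact h4 i hi h
        · have : i = b.pos := by omega
          exact this ▸ h2
      · rcases Nat.lt_or_ge b.pos x.pos with h | h
        · exact absurd h2 (h4 _ le_rfl h)
        · refine Or.inl ⟨by omega, fun i hi hi' => ?_⟩
          have : i = b.pos := by omega
          exact this ▸ h2
    · rcases ih with ⟨h3, h4⟩ | ⟨h3, h4⟩
      · rcases Nat.lt_or_ge x.pos b.pos with h | h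
        · exact absurd (h4 c.pos (by omega) (by omega)) h2
        · refine Or.inr ⟨by omega, fun i hi hi' => ?_⟩
          have : i = c.pos := by omega
          exact this ▸ h2
      · refine Or.inr ⟨by omega, fun i hi hi' => ?_⟩
        rcases Nat.lt_or_ge i b.pos with h | h
        · have : i = c.pos := by omega
          exact this ▸ h2
        · exact h4 i h hi'

/-- The fence `F(α)` as a poset: the order generated by the covering relations. -/
instance (α : List ℕ) : PartialOrder (Fence α) where
  le := Relation.ReflTransGen Fence.Cov
  le_refl _ := Relation.ReflTransGen.refl
  le_trans _ _ _ h h' := h.trans h'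
  le_antisymm x y h h' := by
    have key : x.pos = y.pos := by
      rcases Fence.reflTransGen_cov h with ⟨h1, h2⟩ | ⟨h1, h2⟩ <;>
        rcases Fence.reflTransGen_cov h' with ⟨h3, h4⟩ | ⟨h3, h4⟩
      · omega
      · rcases Nat.lt_or_ge x.pos y.pos with h | h
        · exact absurd (h2 _ le_rfl h) (h4 _ le_rfl h)
        · omega
      · rcases Nat.lt_or_ge y.pos x.pos with h | h
        · exact absurd (h4 _ le_rfl h) (h2 _ le_rfl h)
        · omega
      · omega
    exact Fin.ext key

/-- The distributive lattice `L(α)` of lower order ideals of the fence `F(α)`, ordered by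
inclusion. -/
abbrev L (α : List ℕ) : Type := LowerSet (Fence α)

/-! ### Ranks -/

section Poset

variable {P : Type*} [PartialOrder P]

/-- The rank of an element `x`: the length of a longest chain with top element `x`.  In a finite
ranked poset this is the common length of all saturated chains from a minimal element to `x`. -/
noncomputable def rk (x : P) : ℕ := (Order.height x).toNat

variable (P) in
/-- The rank of a finite poset: the maximum of the ranks of its elements. -/
noncomputable def rank : ℕ := ⨆ x : P, rk x

variable (P) in
/-- The number of elements of rank `k`. -/
noncomputable def rankCount (k : ℕ) : ℕ := Nat.card {x : P // rk x = k}

/-! ### Chain decompositions -/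

variable (P) in
/-- Saturated chains `x = c₀ ⋖ c₁ ⋖ ⋯ ⋖ cₖ = y`, with `k ≥ 0`. -/
abbrev SatChain : Type _ := RelSeries {p : P × P | p.1 ⋖ p.2}

/-- The center of a saturated `x`–`y` chain, `(rk x + rk y) / 2`. -/
noncomputable def SatChain.center (C : SatChain P) : ℚ := ((rk C.head : ℚ) + (rk C.last : ℚ)) / 2

/-- A chain decomposition: a set of saturated chains such that every element of the poset lies on
exactly one of them. -/
def IsChainDecomposition (𝒞 : Set (SatChain P)) : Prop :=
  ∀ x : P, ∃! C : SatChain P, C ∈ 𝒞 ∧ x ∈ C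

variable (P) in
/-- The poset has a symmetric chain decomposition. -/
def HasSymmetricCD : Prop :=
  ∃ 𝒞 : Set (SatChain P), IsChainDecomposition 𝒞 ∧ ∀ C ∈ 𝒞, C.center = (rank P : ℚ) / 2

variable (P) in
/-- The poset has a top centered chain decomposition. -/
def HasTopCenteredCD : Prop :=
  ∃ 𝒞 : Set (SatChain P), IsChainDecomposition 𝒞 ∧
    ∀ C ∈ 𝒞, C.center = (rank P : ℚ) / 2 ∨ C.center = ((rank P : ℚ) + 1) / 2

variable (P) in
/-- The poset has a bottom centered chain decomposition. -/
def HasBottomCenteredCD : Prop :=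
  ∃ 𝒞 : Set (SatChain P), IsChainDecomposition 𝒞 ∧
    ∀ C ∈ 𝒞, C.center = (rank P : ℚ) / 2 ∨ C.center = ((rank P : ℚ) - 1) / 2

end Poset

/-- In the lattice of order ideals of a finite poset, the rank of an ideal is its cardinality. -/
theorem rk_lowerSet {Q : Type*} [PartialOrder Q] [Finite Q] (I : LowerSet Q) :
    rk I = (I : Set Q).ncard := by
  have upper : ∀ I : LowerSet Q, Order.height I ≤ ((I : Set Q).ncard : ℕ∞) := fun I => by
    have hf : StrictMono fun J : LowerSet Q => (J : Set Q).ncard := fun J K h =>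
      Set.ncard_lt_ncard (LowerSet.coe_ssubset_coe.mpr h) (Set.toFinite _)
    simpa [Order.height_nat] using Order.height_le_height_apply_of_strictMono _ hf I
  have lower : ∀ n : ℕ, ∀ I : LowerSet Q, (I : Set Q).ncard = n → (n : ℕ∞) ≤ Order.height I := by
    intro n
    induction n with
    | zero => intro I _; simp
    | succ n ih =>
      intro I hI
      have hne : (I : Set Q).Nonempty := by
        rw [Set.nonempty_iff_ne_empty]
        intro h
        rw [h, Set.ncard_empty] at hI
        omega
      obtain ⟨m, hm⟩ := (Set.toFinite (I : Set Q)).exists_maximal hne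
      let J : LowerSet Q := ⟨(I : Set Q) \ {m}, fun x y hyx hx =>
        ⟨I.lower hyx hx.1, fun hy => hx.2 (by
          have h1 : y = m := hy
          subst h1
          exact le_antisymm (hm.2 hx.1 hyx) hyx)⟩⟩
      have hJ : (J : Set Q).ncard = n := by
        have h := Set.ncard_sdiff_singleton_add_one hm.1 (Set.toFinite _)
        have h2 : (J : Set Q).ncard = ((I : Set Q) \ {m}).ncard := rfl
        omega
      have hlt : J < I := by
        refine lt_of_le_of_ne (fun x hx => hx.1) fun h => ?_
        rw [h] at hJ
        omega
      have := Order.height_add_one_le hlt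
      push_cast
      exact (add_le_add_left (ih J hJ) 1).trans this
  have h : Order.height I = ((I : Set Q).ncard : ℕ∞) := le_antisymm (upper I) (lower _ I rfl)
  rw [rk, h, ENat.toNat_natCast]

/-- The rank of `L(α)` is the number of elements of the fence `F(α)`. -/
theorem rank_L (α : List ℕ) : rank (L α) = α.sum + 1 := by
  have hc : Nat.card (Fence α) = α.sum + 1 := Nat.card_fin _
  have hb : ∀ I : L α, rk I ≤ α.sum + 1 := fun I => by
    rw [rk_lowerSet, ← hc]
    exact Set.ncard_le_card _
  refine le_antisymm (ciSup_le hb) ?_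
  have h := le_ciSup (f := fun I : L α => rk I) ⟨α.sum + 1, by rintro _ ⟨I, rfl⟩; exact hb I⟩ ⊤
  rw [rk_lowerSet, LowerSet.coe_top, Set.ncard_univ, hc] at h
  exact h

/-! ### Properties of finite sequences `a₀, a₁, …, aₙ` -/

/-- `aₖ = aₙ₋ₖ` for `k < n / 2`. -/
def SeqSymmetric (n : ℕ) (a : ℕ → ℕ) : Prop := ∀ k, 2 * k < n → a k = a (n - k)

/-- `a₀ ≤ aₙ ≤ a₁ ≤ aₙ₋₁ ≤ a₂ ≤ ⋯ ≤ a_⌈n/2⌉`. -/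
def SeqTopInterlacing (n : ℕ) (a : ℕ → ℕ) : Prop :=
  (∀ k, 2 * k ≤ n → a k ≤ a (n - k)) ∧ ∀ k, 2 * k + 1 ≤ n → a (n - k) ≤ a (k + 1)

/-- `aₙ ≤ a₀ ≤ aₙ₋₁ ≤ a₁ ≤ aₙ₋₂ ≤ ⋯ ≤ a_⌊n/2⌋`. -/
def SeqBottomInterlacing (n : ℕ) (a : ℕ → ℕ) : Prop :=
  (∀ k, 2 * k ≤ n → a (n - k) ≤ a k) ∧ ∀ k, 2 * k + 1 ≤ n → a k ≤ a (n - (k + 1))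

end FenceLattice

namespace FenceLattice

/-! ### Decompositions of sets into saturated chains -/

/-! Write n = a + b + c + 1; one or two parts are the cases b = c = 0 or c = 0. An ideal is
determined by a triple (i, j, k) counting its elements on the rising left segment, on the falling
segment from valley to peak inclusive, and on the rising right segment. The only constraints linking
the coordinates are that a right element forces the valley and that the peak forces the whole left
segment.

Slice the triples by m = min(i, c - k). The pairs (i, k) with a given m form a hook, which is a
chain: k grows from 0 to c - m at i = m, then i grows to a. If m < min(a, c), the levels 1 ≤ j ≤ b
give hook × chain, and the levels j = 0 and j = b + 1 contribute one triple each, of ranks m and n -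
m. Peel off the longest chain of this rectangle and extend it by these two triples; the remainder is
again a rectangle (`ChainDec.rectangle_extended`). All chains of the slice then have center n/2.

Only the last slice, m = min(a, c), is asymmetric. For c ≤ a its level j = 0 is a full row, so the
rectangle acquires a row below and only its top is extended: the long chain has center n/2, the
others (n - 1)/2. When a = c the rectangle is a single chain and there are no others. For a < c the
level j = b + 1 is the full row, only the bottom is extended, and the others have center (n + 1)/2.

The rank inequalities follow from the decomposition: by the position of the centers, every chain
meeting one of the two ranks compared also meets the other (`ChainDec.ncard_le_ncard`). -/

/-- `ChainDec ρ K S`: the set `S` is a disjoint union of finitely many chains, each of which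
has exactly one element of each rank in an interval `[lo, hi]` with `K lo hi`. -/
inductive ChainDec {P : Type*} [PartialOrder P] (ρ : P → ℕ) (K : ℕ → ℕ → Prop) : Set P → Prop
  | empty : ChainDec ρ K ∅
  | union_chain {S : Set P} (g : ℕ → P) (lo hi : ℕ) (hS : ChainDec ρ K S) (hK : K lo hi)
      (hle : lo ≤ hi) (hρ : ∀ r, lo ≤ r → r ≤ hi → ρ (g r) = r)
      (hstep : ∀ r, lo ≤ r → r < hi → g r ≤ g (r + 1))
      (hdisj : ∀ r, lo ≤ r → r ≤ hi → g r ∉ S) :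
      ChainDec ρ K (S ∪ g '' Set.Icc lo hi)

namespace ChainDec

variable {P Q : Type*} [PartialOrder P] [PartialOrder Q] {ρ : P → ℕ} {K : ℕ → ℕ → Prop}

theorem union {S T : Set P} (hS : ChainDec ρ K S) (hT : ChainDec ρ K T) (hd : Disjoint S T) :
    ChainDec ρ K (S ∪ T) := by
  induction hT with
  | empty => simpa using hS
  | union_chain g lo hi hT hK hle hρ hstep hdisj ih =>
    rw [Set.disjoint_union_right] at hd
    rw [← Set.union_assoc]
    refine union_chain g lo hi (ih hd.1) hK hle hρ hstep fun r h1 h2 h => ?_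
    rcases h with h | h
    · exact Set.disjoint_left.mp hd.2 h ⟨r, ⟨h1, h2⟩, rfl⟩
    · exact hdisj r h1 h2 h

theorem image {ρ' : Q → ℕ} {S : Set P} (hS : ChainDec ρ K S) (f : P → Q)
    (hρf : ∀ x ∈ S, ρ' (f x) = ρ x) (hmono : ∀ x ∈ S, ∀ y ∈ S, x ≤ y → f x ≤ f y)
    (hinj : Set.InjOn f S) : ChainDec ρ' K (f '' S) := by
  induction hS with
  | empty => simpa using empty
  | @union_chain S g lo hi hS hK hle hρ hstep hdisj ih =>
    have hg : ∀ r, lo ≤ r → r ≤ hi → g r ∈ S ∪ g '' Set.Icc lo hi :=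
      fun r h1 h2 => Or.inr ⟨r, ⟨h1, h2⟩, rfl⟩
    rw [Set.image_union, Set.image_image]
    refine union_chain (fun r => f (g r)) lo hi
      (ih (fun x hx => hρf x (Or.inl hx))
        (fun x hx y hy => hmono x (Or.inl hx) y (Or.inl hy))
        (hinj.mono Set.subset_union_left)) hK hle ?_ ?_ ?_
    · intro r h1 h2
      rw [hρf _ (hg r h1 h2), hρ r h1 h2]
    · intro r h1 h2
      exact hmono _ (hg r h1 h2.le) _ (hg (r + 1) (by omega) h2) (hstep r h1 h2)
    · rintro r h1 h2 ⟨x, hx, hxr⟩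
      have := hinj (Or.inl hx) (hg r h1 h2) hxr
      exact hdisj r h1 h2 (this ▸ hx)

/-- Decompositions of the fibres of a function fit together. -/
theorem of_fibers {S : Set P} (l : P → ℕ) (N : ℕ)
    (h : ∀ m < N, ChainDec ρ K {x ∈ S | l x = m}) : ChainDec ρ K {x ∈ S | l x < N} := by
  induction N with
  | zero => simpa using empty
  | succ N ih =>
    have := (ih fun m hm => h m (by omega)).union (h N (by omega))
      (Set.disjoint_left.mpr fun x hx hx' => by have := hx.2; have := hx'.2; omega)
    convert this using 1
    ext x
    simp only [Set.mem_ofPred_eq, Set.mem_union, ← and_or_left, Nat.lt_succ_iff_lt_or_eq]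

/-- A product of two chains with `m` and `n` elements has a symmetric chain decomposition. -/
theorem rectangle (m : ℕ) : ∀ (n d : ℕ) (φ : ℕ → ℕ → P)
    (_ : ∀ u v, u < m → v < n → ρ (φ u v) = d + u + v)
    (_ : ∀ u v, u + 1 < m → v < n → φ u v ≤ φ (u + 1) v)
    (_ : ∀ u v, u < m → v + 1 < n → φ u v ≤ φ u (v + 1))
    (_ : ∀ u v u' v', u < m → v < n → u' < m → v' < n → φ u v = φ u' v' → u = u' ∧ v = v')
    (_ : ∀ lo hi, 0 < m → 0 < n → lo + hi + 2 = 2 * d + m + n → K lo hi),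
    ChainDec ρ K {x | ∃ u v, u < m ∧ v < n ∧ φ u v = x} := by
  induction m with
  | zero => intros; simpa using empty
  | succ m ih =>
    intro n d φ hρ h1 h2 hinj hK
    cases n with
    | zero => simpa using empty
    | succ n =>
      have rest := ih n (d + 1) (fun u v => φ (u + 1) v)
        (fun u v hu hv => by rw [hρ _ _ (by omega) (by omega)]; omega)
        (fun u v hu hv => h1 _ _ (by omega) (by omega))
        (fun u v hu hv => h2 _ _ (by omega) (by omega))
        (fun u v u' v' hu hv hu' hv' h => by
          have := hinj _ _ _ _ (by omega) (by omega) (by omega) (by omega) h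
          omega)
        (fun lo hi _ _ h => hK lo hi (by omega) (by omega) (by omega))
      -- Truncated subtraction keeps the first coordinate at 0 until the second reaches n: the path
      -- runs up the edge u = 0, then along the edge v = n.
      have := union_chain (fun r => φ (r - d - n) (min (r - d) n)) d (d + m + n) rest
        (hK _ _ (by omega) (by omega) (by omega)) (by omega)
        (fun r hr hr' => by rw [hρ _ _ (by omega) (by omega)]; omega)
        (fun r hr hr' => by
          rcases Nat.lt_or_ge (r - d) n with h | h
          · have e1 : r + 1 - d - n = r - d - n := by omega
            have e2 : min (r + 1 - d) n = min (r - d) n + 1 := by omega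
            simp only [e1, e2]
            exact h2 _ _ (by omega) (by omega)
          · have e1 : r + 1 - d - n = r - d - n + 1 := by omega
            have e2 : min (r + 1 - d) n = min (r - d) n := by omega
            simp only [e1, e2]
            exact h1 _ _ (by omega) (by omega))
        (by
          rintro r hr hr' ⟨u, v, hu, hv, h⟩
          have := hinj _ _ _ _ (by omega) (by omega) (by omega) (by omega) h
          omega)
      convert this using 1
      ext x
      constructor
      · rintro ⟨u, v, hu, hv, rfl⟩
        by_cases h : u = 0 ∨ v = n
        · refine Or.inr ⟨d + u + v, ⟨by omega, by omega⟩, ?_⟩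
          have e1 : d + u + v - d - n = u := by omega
          have e2 : min (d + u + v - d) n = v := by omega
          simp only [e1, e2]
        · refine Or.inl ⟨u - 1, v, by omega, by omega, ?_⟩
          have e1 : u - 1 + 1 = u := by omega
          simp only [e1]
      · rintro (⟨u, v, hu, hv, rfl⟩ | ⟨r, ⟨hr, hr'⟩, rfl⟩)
        · exact ⟨u + 1, v, by omega, by omega, rfl⟩
        · exact ⟨_, _, by omega, by omega, rfl⟩

/-- A product of two chains with `m + 1` and `n + 1` elements, whose longest chain (up along the
second factor, then along the first) is extended to a chain `g`. -/
theorem rectangle_extended (m n d lo hi : ℕ) (φ : ℕ → ℕ → P) (g : ℕ → P)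
    (hρ : ∀ u v, u ≤ m → v ≤ n → ρ (φ u v) = d + u + v)
    (h1 : ∀ u v, u < m → v ≤ n → φ u v ≤ φ (u + 1) v)
    (h2 : ∀ u v, u ≤ m → v < n → φ u v ≤ φ u (v + 1))
    (hinj : ∀ u v u' v', u ≤ m → v ≤ n → u' ≤ m → v' ≤ n → φ u v = φ u' v' → u = u' ∧ v = v')
    (hK : ∀ lo hi, 0 < m → 0 < n → lo + hi = 2 * d + m + n → K lo hi)
    (hlo : lo ≤ d) (hhi : d + m + n ≤ hi) (hKg : K lo hi)
    (hgρ : ∀ r, lo ≤ r → r ≤ hi → ρ (g r) = r)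
    (hg : ∀ r, lo ≤ r → r < hi → g r ≤ g (r + 1))
    (hgφ : ∀ u v, u ≤ m → v ≤ n → u = 0 ∨ v = n → g (d + u + v) = φ u v) :
    ChainDec ρ K {x | (∃ u v, u ≤ m ∧ v ≤ n ∧ φ u v = x) ∨ ∃ r, lo ≤ r ∧ r ≤ hi ∧ g r = x} := by
  have rest := rectangle (ρ := ρ) (K := K) m n (d + 1) (fun u v => φ (u + 1) v)
    (fun u v hu hv => by rw [hρ _ _ (by omega) (by omega)]; omega)
    (fun u v hu hv => h1 _ _ (by omega) (by omega))
    (fun u v hu hv => h2 _ _ (by omega) (by omega))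
    (fun u v u' v' hu hv hu' hv' h => by
      have := hinj _ _ _ _ (by omega) (by omega) (by omega) (by omega) h
      omega)
    (fun lo hi _ _ h => hK lo hi (by omega) (by omega) (by omega))
  have := union_chain g lo hi rest hKg (by omega) hgρ hg (by
    rintro r hr hr' ⟨u, v, hu, hv, h⟩
    -- Equality of ranks puts r within the ranks of the rectangle, where `g` runs along the removed
    -- edges; injectivity of `φ` then excludes u + 1 with v < n.
    have e := hgρ r hr hr'
    rw [← h, hρ _ _ (by omega) (by omega)] at e
    rcases le_total (r - d) n with h' | h'
    · have e1 := hgφ 0 (r - d) (by omega) h' (Or.inl rfl)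
      rw [show d + 0 + (r - d) = r by omega, ← h] at e1
      have := hinj _ _ _ _ (by omega) (by omega) (by omega) (by omega) e1
      omega
    · have e1 := hgφ (r - d - n) n (by omega) le_rfl (Or.inr rfl)
      rw [show d + (r - d - n) + n = r by omega, ← h] at e1
      have := hinj _ _ _ _ (by omega) (by omega) (by omega) (by omega) e1
      omega)
  convert this using 1
  ext x
  constructor
  · rintro (⟨u, v, hu, hv, rfl⟩ | ⟨r, hr, hr', rfl⟩)
    · by_cases h : u = 0 ∨ v = n
      · exact Or.inr ⟨d + u + v, ⟨by omega, by omega⟩, hgφ u v hu hv h⟩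
      · refine Or.inl ⟨u - 1, v, by omega, by omega, ?_⟩
        have e1 : u - 1 + 1 = u := by omega
        simp only [e1]
    · exact Or.inr ⟨r, ⟨hr, hr'⟩, rfl⟩
  · rintro (⟨u, v, hu, hv, rfl⟩ | ⟨r, ⟨hr, hr'⟩, rfl⟩)
    · exact Or.inl ⟨u + 1, v, by omega, by omega, rfl⟩
    · exact Or.inr ⟨r, hr, hr', rfl⟩

/-- If each chain that reaches rank `k` also reaches rank `k'`, then at least as many elements
have rank `k'` as have rank `k`. -/
theorem ncard_le_ncard [Finite P] {S : Set P} (hS : ChainDec ρ K S) (k k' : ℕ)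
    (hk : ∀ lo hi, K lo hi → lo ≤ k → k ≤ hi → lo ≤ k' ∧ k' ≤ hi) :
    {x ∈ S | ρ x = k}.ncard ≤ {x ∈ S | ρ x = k'}.ncard := by
  induction hS with
  | empty => simp
  | @union_chain S g lo hi hS hK hle hρ hstep hdisj ih =>
    by_cases h : lo ≤ k ∧ k ≤ hi
    · have key : ∀ j, lo ≤ j → j ≤ hi → {x ∈ S ∪ g '' Set.Icc lo hi | ρ x = j}.ncard
          = {x ∈ S | ρ x = j}.ncard + 1 := by
        intro j h1 h2
        rw [← Set.ncard_insert_of_notMem (a := g j) (fun h => hdisj j h1 h2 h.1)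
          (Set.toFinite _)]
        congr 1
        ext x
        constructor
        · rintro ⟨hx | ⟨r, ⟨h3, h4⟩, rfl⟩, hxj⟩
          · exact Or.inr ⟨hx, hxj⟩
          · rw [hρ r h3 h4] at hxj
            exact Or.inl (by rw [hxj])
        · rintro (rfl | hx)
          · exact ⟨Or.inr ⟨j, ⟨h1, h2⟩, rfl⟩, hρ j h1 h2⟩
          · exact ⟨Or.inl hx.1, hx.2⟩
      obtain ⟨h1, h2⟩ := hk lo hi hK h.1 h.2
      rw [key k h.1 h.2, key k' h1 h2]
      omega
    · have e : {x ∈ S ∪ g '' Set.Icc lo hi | ρ x = k} = {x ∈ S | ρ x = k} := by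
        ext x
        constructor
        · rintro ⟨hx | ⟨r, ⟨h3, h4⟩, rfl⟩, hxj⟩
          · exact ⟨hx, hxj⟩
          · rw [hρ r h3 h4] at hxj
            exact absurd ⟨hxj ▸ h3, hxj ▸ h4⟩ h
        · exact fun hx => ⟨Or.inl hx.1, hx.2⟩
      rw [e]
      exact ih.trans (Set.ncard_le_ncard (fun x hx => ⟨Or.inl hx.1, hx.2⟩) (Set.toFinite _))

/-- That no chain leaves S is carried along for the induction: it keeps a newly added chain disjoint
from the earlier ones, which gives uniqueness. -/
theorem exists_satChains (hcov : ∀ x y : P, x ≤ y → ρ y = ρ x + 1 → x ⋖ y) {S : Set P}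
    (hS : ChainDec ρ K S) :
    ∃ 𝒞 : Set (SatChain P), (∀ x ∈ S, ∃! C : SatChain P, C ∈ 𝒞 ∧ x ∈ C) ∧
      (∀ C ∈ 𝒞, ∀ x ∈ C, x ∈ S) ∧ ∀ C ∈ 𝒞, K (ρ C.head) (ρ C.last) := by
  induction hS with
  | empty => exact ⟨∅, by simp, by simp, by simp⟩
  | @union_chain S g lo hi hS hK hle hρ hstep hdisj ih =>
    obtain ⟨𝒞, h1, h2, h3⟩ := ih
    let D : SatChain P := ⟨hi - lo, fun i => g (lo + i), fun i => by
      have hi' := i.2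
      simp only [Fin.val_castSucc, Fin.val_succ, Set.mem_ofPred_eq]
      refine hcov _ _ (hstep _ (by omega) (by omega)) ?_
      rw [show lo + (i.1 + 1) = lo + i.1 + 1 by omega, hρ _ (by omega) (by omega),
        hρ _ (by omega) (by omega)]⟩
    have hD : ∀ x, x ∈ D ↔ x ∈ g '' Set.Icc lo hi := by
      intro x
      constructor
      · rintro ⟨i, rfl⟩
        have hi' : i.1 < hi - lo + 1 := i.2
        exact ⟨lo + i, ⟨by omega, by omega⟩, rfl⟩
      · rintro ⟨r, ⟨hr, hr'⟩, rfl⟩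
        refine ⟨(⟨r - lo, by omega⟩ : Fin (hi - lo + 1)), ?_⟩
        change g (lo + (r - lo)) = g r
        rw [show lo + (r - lo) = r by omega]
    refine ⟨insert D 𝒞, ?_, ?_, ?_⟩
    · rintro x (hx | hx)
      · obtain ⟨C, hC, hu⟩ := h1 x hx
        refine ⟨C, ⟨Or.inr hC.1, hC.2⟩, ?_⟩
        rintro C' ⟨rfl | hC', hx'⟩
        · obtain ⟨r, ⟨hr, hr'⟩, rfl⟩ := (hD x).mp hx'
          exact absurd hx (hdisj r hr hr')
        · exact hu C' ⟨hC', hx'⟩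
      · refine ⟨D, ⟨Or.inl rfl, (hD x).mpr hx⟩, ?_⟩
        rintro C' ⟨rfl | hC', hx'⟩
        · rfl
        · obtain ⟨r, ⟨hr, hr'⟩, rfl⟩ := hx
          exact absurd (h2 C' hC' _ hx') (hdisj r hr hr')
    · rintro C (rfl | hC) x hx
      · exact Or.inr ((hD x).mp hx)
      · exact Or.inl (h2 C hC x hx)
    · rintro C (rfl | hC)
      · have e1 : D.head = g lo := rfl
        have e2 : D.last = g hi := by
          change g (lo + (hi - lo)) = g hi
          rw [show lo + (hi - lo) = hi by omega]
        rw [e1, e2, hρ lo le_rfl hle, hρ hi hle le_rfl]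
        exact hK
      · exact h3 C hC

end ChainDec

/-! ### Coordinates on the lattice of ideals -/

/-- The triples `(i, j, k)` that describe the ideals of a fence with (at most) three segments of
lengths `a`, `b`, `c`: such an ideal has `i` elements left of the peak, `j` elements from the valley
to the peak, and `k` elements right of the valley. -/
def triples (a b c : ℕ) : Set (ℕ × ℕ × ℕ) :=
  {t | t.1 ≤ a ∧ t.2.1 ≤ b + 1 ∧ t.2.2 ≤ c ∧ (t.2.1 = 0 → t.2.2 = 0) ∧ (t.2.1 = b + 1 → t.1 = a)}

/-- The size of the ideal with the given coordinates. -/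
def tripleRank (t : ℕ × ℕ × ℕ) : ℕ := t.1 + t.2.1 + t.2.2

theorem tripleRank_mk (i j k : ℕ) : tripleRank (i, j, k) = i + j + k := rfl

theorem mem_triples {a b c i j k : ℕ} : (i, j, k) ∈ triples a b c ↔
    i ≤ a ∧ j ≤ b + 1 ∧ k ≤ c ∧ (j = 0 → k = 0) ∧ (j = b + 1 → i = a) := Iff.rfl

/-! ### Decomposing the triples hook by hook -/

/-- The part of `triples a b c` above the `m`-th hook `(m, 0), …, (m, c - m), …, (a, c - m)` in the
product of the outer segments. -/
theorem chainDec_hook {K : ℕ → ℕ → Prop} {a b c m : ℕ} (hb : 0 < b) (ha : m < a) (hc : m < c)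
    (hK : ∀ lo hi, lo + hi = a + b + c + 1 → K lo hi) :
    ChainDec tripleRank K {t ∈ triples a b c | min t.1 (c - t.2.2) = m} := by
  -- Here u is the position along the hook and v + 1 is the middle coordinate. The long chain starts
  -- at (m, 0, 0), raises j to b at the start of the hook, follows the hook, and ends at (a, b + 1,
  -- c - m).
  have := ChainDec.rectangle_extended (ρ := tripleRank) (K := K) (a + c - 2 * m) (b - 1) (m + 1) m
    (a + b + c + 1 - m) (fun u v => (m + (u - (c - m)), v + 1, min u (c - m)))
    (fun r => if r = m then (m, 0, 0) else if r = a + b + c + 1 - m then (a, b + 1, c - m) else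
      (m + (r - (m + 1) - (b - 1) - (c - m)), min (r - (m + 1)) (b - 1) + 1,
        min (r - (m + 1) - (b - 1)) (c - m)))
    (fun u v hu hv => by simp only [tripleRank_mk]; omega)
    (fun u v hu hv => by simp only [Prod.mk_le_mk]; omega)
    (fun u v hu hv => by simp only [Prod.mk_le_mk]; omega)
    (fun u v u' v' hu hv hu' hv' h => by simp only [Prod.mk.injEq] at h; omega)
    (fun lo hi _ _ h => hK _ _ (by omega)) (by omega) (by omega) (hK _ _ (by omega))
    (fun r hr hr' => by split_ifs <;> simp only [tripleRank_mk] <;> omega)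
    (fun r hr hr' => by split_ifs <;> simp only [Prod.mk_le_mk] <;> omega)
    (fun u v hu hv h => by
      rw [if_neg (by omega), if_neg (by omega)]
      simp only [Prod.mk.injEq]
      omega)
  convert this using 1
  ext ⟨i, j, k⟩
  simp only [Set.mem_ofPred_eq, mem_triples]
  constructor
  · rintro ⟨⟨h1, h2, h3, h4, h5⟩, h6⟩
    by_cases h0 : j = 0
    · refine Or.inr ⟨m, by omega, by omega, ?_⟩
      simp only [if_pos, Prod.mk.injEq]
      omega
    by_cases h0' : j = b + 1
    · refine Or.inr ⟨a + b + c + 1 - m, by omega, by omega, ?_⟩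
      rw [if_neg (by omega), if_pos rfl]
      simp only [Prod.mk.injEq]
      omega
    · refine Or.inl ⟨i - m + k, j - 1, by omega, by omega, ?_⟩
      simp only [Prod.mk.injEq]
      omega
  · rintro (⟨u, v, hu, hv, h⟩ | ⟨r, hr, hr', h⟩)
    · simp only [Prod.mk.injEq] at h
      omega
    · split_ifs at h <;> simp only [Prod.mk.injEq] at h <;> omega

/-- The slice is k = 0, i ≥ c: a rectangle with 0 ≤ j ≤ b, plus (a, b + 1, 0) on top. The shorter
chains exist only if c < a and b > 0, hence the guards in `hK'`. -/
theorem chainDec_last_hook_of_le {K : ℕ → ℕ → Prop} {a b c : ℕ}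
    (hac : c ≤ a) (hK : ∀ lo hi, lo + hi = a + b + c + 1 → K lo hi)
    (hK' : ∀ lo hi, c < a → 0 < b → lo + hi = a + b + c → K lo hi) :
    ChainDec tripleRank K {t ∈ triples a b c | min t.1 (c - t.2.2) = c} := by
  have := ChainDec.rectangle_extended (ρ := tripleRank) (K := K) (a - c) b c c
    (a + b + 1) (fun u v => (c + u, v, 0))
    (fun r => if r = a + b + 1 then (a, b + 1, 0) else (c + (r - c - b), min (r - c) b, 0))
    (fun u v hu hv => by simp only [tripleRank_mk]; omega)
    (fun u v hu hv => by simp only [Prod.mk_le_mk]; omega)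
    (fun u v hu hv => by simp only [Prod.mk_le_mk]; omega)
    (fun u v u' v' hu hv hu' hv' h => by simp only [Prod.mk.injEq] at h; omega)
    (fun lo hi _ _ h => hK' _ _ (by omega) (by omega) (by omega)) (by omega) (by omega)
    (hK _ _ (by omega))
    (fun r hr hr' => by split_ifs <;> simp only [tripleRank_mk] <;> omega)
    (fun r hr hr' => by split_ifs <;> simp only [Prod.mk_le_mk] <;> omega)
    (fun u v hu hv h => by
      rw [if_neg (by omega)]
      simp only [Prod.mk.injEq, and_true]
      omega)
  convert this using 1
  ext ⟨i, j, k⟩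
  simp only [Set.mem_ofPred_eq, mem_triples]
  constructor
  · rintro ⟨⟨h1, h2, h3, h4, h5⟩, h6⟩
    by_cases h0' : j = b + 1
    · refine Or.inr ⟨a + b + 1, by omega, by omega, ?_⟩
      rw [if_pos rfl]
      simp only [Prod.mk.injEq]
      omega
    · refine Or.inl ⟨i - c, j, by omega, by omega, ?_⟩
      simp only [Prod.mk.injEq, true_and]
      omega
  · rintro (⟨u, v, hu, hv, h⟩ | ⟨r, hr, hr', h⟩)
    · simp only [Prod.mk.injEq] at h
      omega
    · split_ifs at h <;> simp only [Prod.mk.injEq] at h <;> omega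

/-- The slice is i = a, k ≤ c - a: a rectangle with 1 ≤ j ≤ b + 1, plus (a, 0, 0) below. -/
theorem chainDec_last_hook_of_lt {K : ℕ → ℕ → Prop} {a b c : ℕ} (hb : 0 < b) (hac : a < c)
    (hK : ∀ lo hi, lo + hi = a + b + c + 1 ∨ lo + hi = a + b + c + 2 → K lo hi) :
    ChainDec tripleRank K {t ∈ triples a b c | min t.1 (c - t.2.2) = a} := by
  have := ChainDec.rectangle_extended (ρ := tripleRank) (K := K) (c - a) b (a + 1) a
    (b + c + 1) (fun u v => (a, v + 1, u))
    (fun r => if r = a then (a, 0, 0) else (a, min (r - (a + 1)) b + 1, r - (a + 1) - b))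
    (fun u v hu hv => by simp only [tripleRank_mk]; omega)
    (fun u v hu hv => by simp only [Prod.mk_le_mk]; omega)
    (fun u v hu hv => by simp only [Prod.mk_le_mk]; omega)
    (fun u v u' v' hu hv hu' hv' h => by simp only [Prod.mk.injEq] at h; omega)
    (fun lo hi _ _ h => hK _ _ (by omega)) (by omega) (by omega)
    (hK _ _ (by omega))
    (fun r hr hr' => by split_ifs <;> simp only [tripleRank_mk] <;> omega)
    (fun r hr hr' => by split_ifs <;> simp only [Prod.mk_le_mk] <;> omega)
    (fun u v hu hv h => by
      rw [if_neg (by omega)]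
      simp only [Prod.mk.injEq, true_and]
      omega)
  convert this using 1
  ext ⟨i, j, k⟩
  simp only [Set.mem_ofPred_eq, mem_triples]
  constructor
  · rintro ⟨⟨h1, h2, h3, h4, h5⟩, h6⟩
    by_cases h0' : j = 0
    · refine Or.inr ⟨a, by omega, by omega, ?_⟩
      rw [if_pos rfl]
      simp only [Prod.mk.injEq]
      omega
    · refine Or.inl ⟨k, j - 1, by omega, by omega, ?_⟩
      simp only [Prod.mk.injEq, and_true]
      omega
  · rintro (⟨u, v, hu, hv, h⟩ | ⟨r, hr, hr', h⟩)
    · simp only [Prod.mk.injEq] at h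
      omega
    · split_ifs at h <;> simp only [Prod.mk.injEq] at h <;> omega

theorem chainDec_triples_of_le {K : ℕ → ℕ → Prop} {a b c : ℕ} (hbc : 0 < b ∨ c = 0)
    (hac : c ≤ a) (hK : ∀ lo hi, lo + hi = a + b + c + 1 → K lo hi)
    (hK' : ∀ lo hi, c < a → 0 < b → lo + hi = a + b + c → K lo hi) :
    ChainDec tripleRank K (triples a b c) := by
  have := ChainDec.of_fibers (ρ := tripleRank) (K := K) (S := triples a b c)
    (fun t => min t.1 (c - t.2.2)) (c + 1) fun m hm => by
      rcases Nat.lt_or_ge m c with h | h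
      · exact chainDec_hook (by omega) (by omega) h hK
      · obtain rfl : m = c := by omega
        exact chainDec_last_hook_of_le hac hK hK'
  convert this using 1
  ext t
  simp only [Set.mem_ofPred_eq, iff_self_and]
  omega

theorem chainDec_triples_of_lt {K : ℕ → ℕ → Prop} {a b c : ℕ} (hb : 0 < b) (hac : a < c)
    (hK : ∀ lo hi, lo + hi = a + b + c + 1 ∨ lo + hi = a + b + c + 2 → K lo hi) :
    ChainDec tripleRank K (triples a b c) := by
  have := ChainDec.of_fibers (ρ := tripleRank) (K := K) (S := triples a b c)
    (fun t => min t.1 (c - t.2.2)) (a + 1) fun m hm => by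
      rcases Nat.lt_or_ge m a with h | h
      · exact chainDec_hook hb h (by omega) fun lo hi h => hK lo hi (Or.inl h)
      · obtain rfl : m = a := by omega
        exact chainDec_last_hook_of_lt hb hac hK
  convert this using 1
  ext t
  simp only [Set.mem_ofPred_eq, iff_self_and]
  intro h
  have := h.1
  omega

/-! ### Ideals of the fence as triples -/

/-- The fence `F(α)` goes up for `a` steps, then down for `b` steps, then up for `c` steps; some of
these numbers may be zero. -/
def HasShape (α : List ℕ) (a b c : ℕ) : Prop :=
  α.sum = a + b + c ∧ ∀ p < a + b + c, (Even (segment α p) ↔ p < a ∨ a + b ≤ p)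

/-- The set of elements of the ideal with the given coordinates. -/
def tripleSet (α : List ℕ) (a b : ℕ) (t : ℕ × ℕ × ℕ) : Set (Fence α) :=
  {x | x.pos < t.1 ∨ (a + b + 1 - t.2.1 ≤ x.pos ∧ x.pos < a + b + 1 + t.2.2)}

/-- The ideal with the given coordinates. -/
def tripleIdeal (α : List ℕ) (a b : ℕ) (t : ℕ × ℕ × ℕ) : L α := lowerClosure (tripleSet α a b t)

section Coordinates

variable {α : List ℕ} {a b c : ℕ}

theorem Fence.pos_injective : Function.Injective (Fence.pos (α := α)) := fun _ _ h => Fin.ext h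

theorem Fence.pos_lt (x : Fence α) : x.pos < α.sum + 1 := Fin.is_lt (n := α.sum + 1) x

theorem Fence.exists_pos {p : ℕ} (h : p < α.sum + 1) : ∃ x : Fence α, x.pos = p :=
  ⟨(⟨p, h⟩ : Fin (α.sum + 1)), rfl⟩

theorem isLowerSet_of_cov {s : Set (Fence α)} (h : ∀ x y, Fence.Cov x y → y ∈ s → x ∈ s) :
    IsLowerSet s := by
  intro y x hxy hy
  change Relation.ReflTransGen Fence.Cov x y at hxy
  revert hy
  induction hxy with
  | refl => exact id
  | tail _ h2 ih => exact fun hy => ih (h _ _ h2 hy)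

theorem isLowerSet_tripleSet (hα : HasShape α a b c) {t : ℕ × ℕ × ℕ} (ht : t ∈ triples a b c) :
    IsLowerSet (tripleSet α a b t) := by
  obtain ⟨i, j, k⟩ := t
  rw [mem_triples] at ht
  refine isLowerSet_of_cov fun x y hxy hy => ?_
  have hx' := x.pos_lt
  have hy' := y.pos_lt
  have hs := hα.1
  simp only [tripleSet, Set.mem_ofPred_eq] at hy ⊢
  rcases hxy with ⟨h1, h2⟩ | ⟨h1, h2⟩
  · rw [hα.2 _ (by omega)] at h2
    omega
  · rw [hα.2 _ (by omega)] at h2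
    omega

theorem coe_tripleIdeal (hα : HasShape α a b c) {t : ℕ × ℕ × ℕ} (ht : t ∈ triples a b c) :
    (tripleIdeal α a b t : Set (Fence α)) = tripleSet α a b t :=
  (isLowerSet_tripleSet hα ht).lowerClosure

theorem rk_tripleIdeal (hα : HasShape α a b c) {t : ℕ × ℕ × ℕ} (ht : t ∈ triples a b c) :
    rk (tripleIdeal α a b t) = tripleRank t := by
  rw [rk_lowerSet, coe_tripleIdeal hα ht, ← Set.ncard_image_of_injective _ Fence.pos_injective]
  obtain ⟨i, j, k⟩ := t
  rw [mem_triples] at ht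
  have hs := hα.1
  have : Fence.pos '' tripleSet α a b (i, j, k) =
      ((Finset.range i ∪ Finset.Ico (a + b + 1 - j) (a + b + 1 + k) : Finset ℕ) : Set ℕ) := by
    ext p
    simp only [tripleSet, Set.mem_image, Set.mem_ofPred_eq, Finset.coe_union, Finset.coe_range,
      Finset.coe_Ico, Set.mem_union, Set.mem_Iio, Set.mem_Ico]
    constructor
    · rintro ⟨x, hx, rfl⟩
      exact hx
    · intro hp
      obtain ⟨x, rfl⟩ := Fence.exists_pos (α := α) (p := p) (by omega)
      exact ⟨x, hp, rfl⟩
  rw [this, Set.ncard_coe_finset, Finset.card_union_of_disjoint, Finset.card_range, Nat.card_Ico,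
    tripleRank_mk]
  · omega
  · rw [Finset.disjoint_left]
    intro p hp hp'
    rw [Finset.mem_range] at hp
    rw [Finset.mem_Ico] at hp'
    omega

/-- Defining the ideal as a lower closure makes this hold for all triples, admissible or not. -/
theorem tripleIdeal_mono : Monotone (tripleIdeal α a b) := by
  rintro ⟨i, j, k⟩ ⟨i', j', k'⟩ h
  simp only [Prod.mk_le_mk] at h
  refine lowerClosure_mono fun x hx => ?_
  simp only [tripleSet, Set.mem_ofPred_eq] at hx ⊢
  omega

theorem tripleIdeal_injOn (hα : HasShape α a b c) :
    Set.InjOn (tripleIdeal α a b) (triples a b c) := by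
  have key : ∀ t ∈ triples a b c, ∀ t' ∈ triples a b c,
      tripleSet α a b t ⊆ tripleSet α a b t' → t ≤ t' := by
    rintro ⟨i, j, k⟩ ht ⟨i', j', k'⟩ ht' h
    rw [mem_triples] at ht ht'
    have hs := hα.1
    have h' : ∀ p < α.sum + 1, p < i ∨ (a + b + 1 - j ≤ p ∧ p < a + b + 1 + k) →
        p < i' ∨ (a + b + 1 - j' ≤ p ∧ p < a + b + 1 + k') := by
      intro p hp hpt
      obtain ⟨x, rfl⟩ := Fence.exists_pos hp
      exact h hpt
    -- Test positions: the first left position missing from t', the lowest-numbered middle position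
    -- of t, and the first right position missing from t'.
    have e1 := h' i'
    have e2 := h' (a + b + 1 - j)
    have e3 := h' (a + b + 1 + k')
    simp only [Prod.mk_le_mk]
    omega
  intro t ht t' ht' h
  have h' : tripleSet α a b t = tripleSet α a b t' := by
    rw [← coe_tripleIdeal hα ht, ← coe_tripleIdeal hα ht', h]
  exact le_antisymm (key t ht t' ht' h'.le) (key t' ht' t ht h'.ge)

/-- An initial segment of an interval of natural numbers is given by a bound. -/
theorem exists_bound_of_initial (M : ℕ → Prop) (s e : ℕ) (hse : s ≤ e)
    (h : ∀ p, s ≤ p → p + 1 < e → M (p + 1) → M p) :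
    ∃ q, s ≤ q ∧ q ≤ e ∧ ∀ p, s ≤ p → p < e → (M p ↔ p < q) := by
  induction e, hse using Nat.le_induction with
  | base => exact ⟨s, le_rfl, le_rfl, fun p _ _ => by omega⟩
  | succ e hse ih =>
    obtain ⟨q, h1, h2, h3⟩ := ih fun p hp hp' => h p hp (by omega)
    by_cases hM : M e
    · have key : ∀ d, s + d ≤ e → M (e - d) := by
        intro d hd
        induction d with
        | zero => exact hM
        | succ d ihd =>
          refine h _ (by omega) (by omega) ?_
          rw [show e - (d + 1) + 1 = e - d by omega]
          exact ihd (by omega)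
      refine ⟨e + 1, by omega, le_rfl, fun p hp hp' => ⟨fun _ => hp', fun _ => ?_⟩⟩
      have := key (e - p) (by omega)
      rwa [show e - (e - p) = p by omega] at this
    · refine ⟨q, h1, by omega, fun p hp hp' => ?_⟩
      rcases Nat.lt_succ_iff_lt_or_eq.mp hp' with h' | rfl
      · exact h3 p hp h'
      · exact ⟨fun h => absurd h hM, fun h => by omega⟩

/-- A final segment of an interval of natural numbers is given by a bound. -/
theorem exists_bound_of_final (M : ℕ → Prop) (s e : ℕ) (hse : s ≤ e)
    (h : ∀ p, s ≤ p → p + 1 < e → M p → M (p + 1)) :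
    ∃ q, s ≤ q ∧ q ≤ e ∧ ∀ p, s ≤ p → p < e → (M p ↔ q ≤ p) := by
  obtain ⟨q, h1, h2, h3⟩ := exists_bound_of_initial (fun p => ¬ M p) s e hse
    fun p hp hp' hM hM' => hM (h p hp hp' hM')
  exact ⟨q, h1, h2, fun p hp hp' => by rw [← not_lt, ← h3 p hp hp', not_not]⟩

/-- An ideal meets the left and right segments in initial intervals of positions and the middle one,
which descends, in a final interval; the three cut points give the triple. -/
theorem tripleIdeal_surjOn (hα : HasShape α a b c) :
    tripleIdeal α a b '' triples a b c = Set.univ := by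
  rw [Set.eq_univ_iff_forall]
  intro I
  have hs := hα.1
  let M : ℕ → Prop := fun p => ∃ x ∈ I, x.pos = p
  have up : ∀ p, p < a ∨ (a + b ≤ p ∧ p < a + b + c) → M (p + 1) → M p := by
    rintro p hp ⟨y, hy, hyp⟩
    obtain ⟨x, rfl⟩ := Fence.exists_pos (α := α) (p := p) (by omega)
    exact ⟨x, I.lower (Relation.ReflTransGen.single
      (Or.inl ⟨hyp, (hα.2 _ (by omega)).mpr (by omega)⟩)) hy, rfl⟩
  have down : ∀ p, a ≤ p → p < a + b → M p → M (p + 1) := by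
    rintro p h1 h2 ⟨y, hy, rfl⟩
    obtain ⟨x, hx⟩ := Fence.exists_pos (α := α) (p := y.pos + 1) (by omega)
    exact ⟨x, I.lower (Relation.ReflTransGen.single
      (Or.inr ⟨hx, fun h => by rw [hα.2 _ (by omega)] at h; omega⟩)) hy, hx⟩
  obtain ⟨i, _, hi, hi'⟩ := exists_bound_of_initial M 0 a (by omega)
    fun p _ h => up p (by omega)
  obtain ⟨q, hq, hq', hq''⟩ := exists_bound_of_final M a (a + b + 1) (by omega)
    fun p h h' => down p h (by omega)
  obtain ⟨l, hl, hl', hl''⟩ := exists_bound_of_initial M (a + b + 1) (a + b + c + 1) (by omega)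
    fun p h h' => up p (by omega)
  have ht : (i, a + b + 1 - q, l - (a + b + 1)) ∈ triples a b c := by
    rw [mem_triples]
    -- A nonempty right part puts the valley a + b in the ideal; the peak, if present, puts position
    -- a - 1 in it.
    refine ⟨hi, by omega, by omega, fun h => ?_, fun h => ?_⟩
    · by_contra hne
      have := (hq'' (a + b) (by omega) (by omega)).mp
        (up _ (by omega) ((hl'' (a + b + 1) le_rfl (by omega)).mpr (by omega)))
      omega
    · by_contra hne
      have hMa := (hq'' a le_rfl (by omega)).mpr (by omega)
      obtain ⟨a', rfl⟩ : ∃ a', a = a' + 1 := ⟨a - 1, by omega⟩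
      have := (hi' a' (by omega) (by omega)).mp (up _ (by omega) hMa)
      omega
  refine ⟨_, ht, SetLike.coe_injective ?_⟩
  rw [coe_tripleIdeal hα ht]
  ext x
  have hx := x.pos_lt
  have hM : x ∈ (I : Set (Fence α)) ↔ M x.pos :=
    ⟨fun h => ⟨x, h, rfl⟩, fun ⟨y, hy, hyx⟩ => Fence.pos_injective hyx ▸ hy⟩
  rw [hM]
  simp only [tripleSet, Set.mem_ofPred_eq]
  rcases Nat.lt_or_ge x.pos a with h | h
  · rw [hi' _ (by omega) h]
    omega
  rcases Nat.lt_or_ge x.pos (a + b + 1) with h' | h'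
  · rw [hq'' _ h h']
    omega
  · rw [hl'' _ h' (by omega)]
    omega

theorem chainDec_univ {K : ℕ → ℕ → Prop} (hα : HasShape α a b c)
    (h : ChainDec tripleRank K (triples a b c)) : ChainDec (rk (P := L α)) K Set.univ := by
  rw [← tripleIdeal_surjOn hα]
  exact h.image _ (fun t ht => rk_tripleIdeal hα ht) (fun _ _ _ _ h => tripleIdeal_mono h)
    (tripleIdeal_injOn hα)

end Coordinates

/-! ### Centered chain decompositions of the lattice of ideals -/

section Centered

variable {α : List ℕ}

instance : Finite (L α) := Finite.of_injective _ (SetLike.coe_injective (A := L α))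

theorem covBy_of_rk {I J : L α} (h : I ≤ J) (hr : rk J = rk I + 1) : I ⋖ J := by
  have mono : ∀ {I J : L α}, I < J → rk I < rk J := fun {I J} h => by
    rw [rk_lowerSet, rk_lowerSet]
    exact Set.ncard_lt_ncard (LowerSet.coe_ssubset_coe.mpr h) (Set.toFinite _)
  refine ⟨lt_of_le_of_ne h fun e => by rw [e] at hr; omega, fun X h1 h2 => ?_⟩
  have := mono h1
  have := mono h2
  omega

theorem rankCount_eq_ncard (k : ℕ) :
    rankCount (L α) k = {x ∈ (Set.univ : Set (L α)) | rk x = k}.ncard := by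
  simp only [Set.mem_univ, true_and]
  rfl

theorem exists_decomposition {K : ℕ → ℕ → Prop} (h : ChainDec (rk (P := L α)) K Set.univ) :
    ∃ 𝒞 : Set (SatChain (L α)), IsChainDecomposition 𝒞 ∧
      ∀ C ∈ 𝒞, K (rk C.head) (rk C.last) := by
  obtain ⟨𝒞, h1, _, h3⟩ := h.exists_satChains fun _ _ => covBy_of_rk
  exact ⟨𝒞, fun x => h1 x trivial, h3⟩

theorem symmetric_of_chainDec
    (h : ChainDec (rk (P := L α)) (fun lo hi => lo + hi = rank (L α)) Set.univ) :
    HasSymmetricCD (L α) ∧ SeqSymmetric (rank (L α)) (rankCount (L α)) := by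
  constructor
  · obtain ⟨𝒞, h1, h2⟩ := exists_decomposition h
    refine ⟨𝒞, h1, fun C hC => ?_⟩
    rw [SatChain.center, ← h2 C hC]
    push_cast
    rfl
  · intro k hk
    rw [rankCount_eq_ncard, rankCount_eq_ncard]
    exact le_antisymm (h.ncard_le_ncard _ _ fun lo hi h1 h2 h3 => by omega)
      (h.ncard_le_ncard _ _ fun lo hi h1 h2 h3 => by omega)

theorem bottomCentered_of_chainDec
    (h : ChainDec (rk (P := L α))
      (fun lo hi => lo + hi = rank (L α) ∨ lo + hi + 1 = rank (L α)) Set.univ) :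
    HasBottomCenteredCD (L α) ∧ SeqBottomInterlacing (rank (L α)) (rankCount (L α)) := by
  constructor
  · obtain ⟨𝒞, h1, h2⟩ := exists_decomposition h
    refine ⟨𝒞, h1, fun C hC => ?_⟩
    rw [SatChain.center]
    rcases h2 C hC with h3 | h3 <;> rw [← h3] <;> push_cast
    · exact Or.inl rfl
    · exact Or.inr (by ring)
  · simp only [SeqBottomInterlacing, rankCount_eq_ncard]
    exact ⟨fun k hk => h.ncard_le_ncard _ _ fun lo hi h1 h2 h3 => by omega,
      fun k hk => h.ncard_le_ncard _ _ fun lo hi h1 h2 h3 => by omega⟩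

theorem topCentered_of_chainDec
    (h : ChainDec (rk (P := L α))
      (fun lo hi => lo + hi = rank (L α) ∨ lo + hi = rank (L α) + 1) Set.univ) :
    HasTopCenteredCD (L α) ∧ SeqTopInterlacing (rank (L α)) (rankCount (L α)) := by
  constructor
  · obtain ⟨𝒞, h1, h2⟩ := exists_decomposition h
    refine ⟨𝒞, h1, fun C hC => ?_⟩
    rw [SatChain.center]
    rcases h2 C hC with h3 | h3
    · exact Or.inl (by rw [← h3]; push_cast; rfl)
    · refine Or.inr ?_
      have : ((rank (L α) + 1 : ℕ) : ℚ) = rk C.head + rk C.last := by rw [← h3]; push_cast; rfl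
      rw [← this]
      push_cast
      rfl
  · simp only [SeqTopInterlacing, rankCount_eq_ncard]
    exact ⟨fun k hk => h.ncard_le_ncard _ _ fun lo hi h1 h2 h3 => by omega,
      fun k hk => h.ncard_le_ncard _ _ fun lo hi h1 h2 h3 => by omega⟩

/-! ### Fences with one, two or three parts -/

variable {a b c : ℕ}

theorem HasShape.rank_eq (hα : HasShape α a b c) : rank (L α) = a + b + c + 1 := by
  rw [rank_L, hα.1]

/-- Covers both a = c and the one-part fence. In either case c < a and 0 < b cannot both hold, so no
off-center chain arises. -/
theorem HasShape.symmetric (hα : HasShape α a b c) (hbc : 0 < b ∧ a = c ∨ b = 0 ∧ c = 0) :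
    HasSymmetricCD (L α) ∧ SeqSymmetric (rank (L α)) (rankCount (L α)) :=
  symmetric_of_chainDec (chainDec_univ hα (chainDec_triples_of_le (by omega) (by omega)
    (fun lo hi h => by rw [hα.rank_eq, h]) fun lo hi h1 h2 h => by omega))

theorem HasShape.bottomCentered (hα : HasShape α a b c) (hac : c ≤ a) (hbc : 0 < b ∨ c = 0) :
    HasBottomCenteredCD (L α) ∧ SeqBottomInterlacing (rank (L α)) (rankCount (L α)) :=
  bottomCentered_of_chainDec (chainDec_univ hα (chainDec_triples_of_le hbc hac
    (fun lo hi h => by rw [hα.rank_eq]; omega) fun lo hi h1 h2 h => by rw [hα.rank_eq]; omega))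

theorem HasShape.topCentered (hα : HasShape α a b c) (hac : a < c) (hb : 0 < b) :
    HasTopCenteredCD (L α) ∧ SeqTopInterlacing (rank (L α)) (rankCount (L α)) :=
  topCentered_of_chainDec (chainDec_univ hα (chainDec_triples_of_lt hb hac
    fun lo hi h => by rw [hα.rank_eq]; omega))

theorem HasShape.rankCount_eq_one (hα : HasShape α a 0 0) {k : ℕ} (hk : k ≤ rank (L α)) :
    rankCount (L α) k = 1 := by
  rw [hα.rank_eq] at hk
  rw [rankCount_eq_ncard, Set.ncard_eq_one]
  -- The middle coordinate k - a is 1 only at the top rank k = a + 1, where the peak enters;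
  -- otherwise it truncates to 0.
  have ht : (min k a, k - a, 0) ∈ triples a 0 0 := by
    rw [mem_triples]
    omega
  refine ⟨tripleIdeal α a 0 (min k a, k - a, 0), ?_⟩
  ext I
  simp only [Set.mem_univ, true_and, Set.mem_ofPred_eq, Set.mem_singleton_iff]
  constructor
  · intro hI
    obtain ⟨⟨i, j, l⟩, hT, rfl⟩ := (tripleIdeal_surjOn hα).ge (Set.mem_univ I)
    rw [rk_tripleIdeal hα hT, tripleRank_mk] at hI
    rw [mem_triples] at hT
    congr 1
    simp only [Prod.mk.injEq]
    omega
  · rintro rfl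
    rw [rk_tripleIdeal hα ht, tripleRank_mk]
    omega

theorem hasShape_nil : HasShape [] 0 0 0 := ⟨rfl, fun p hp => by omega⟩

theorem hasShape_singleton (a : ℕ) : HasShape [a] a 0 0 := by
  refine ⟨by simp, fun p hp => ?_⟩
  have : p < a := by omega
  simp [segment, this]

theorem hasShape_pair (a b : ℕ) : HasShape [a, b] a b 0 := by
  refine ⟨by simp, fun p hp => ?_⟩
  rcases Nat.lt_or_ge p a with h | h
  · simp [segment, h]
  · have h1 : p - a < b := by omega
    have h2 : ¬ p < a := by omega
    have h3 : ¬ a + b ≤ p := by omega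
    simp [segment, h1, h2, h3]

theorem hasShape_triple (a b c : ℕ) : HasShape [a, b, c] a b c := by
  refine ⟨by simp [Nat.add_assoc], fun p hp => ?_⟩
  rcases Nat.lt_or_ge p a with h | h
  · simp [segment, h]
  · have h2 : ¬ p < a := by omega
    rcases Nat.lt_or_ge p (a + b) with h' | h'
    · have h1 : p - a < b := by omega
      have h3 : ¬ a + b ≤ p := by omega
      simp [segment, h1, h2, h3]
    · have h1 : ¬ p - a < b := by omega
      have h3 : p - a - b < c := by omega
      simp [segment, h1, h2, h3, h']

end Centered

end FenceLattice

open FenceLattice in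
theorem theorem1p6 (α : List ℕ) (hpos : ∀ p ∈ α, 0 < p) (hlen : α.length ≤ 3) :
    (α.length = 1 →
      HasSymmetricCD (L α) ∧
      (∀ k ≤ rank (L α), rankCount (L α) k = 1) ∧
      SeqSymmetric (rank (L α)) (rankCount (L α))) ∧
    (Even α.length →
      HasBottomCenteredCD (L α) ∧
      SeqBottomInterlacing (rank (L α)) (rankCount (L α))) ∧
    (∀ a b c : ℕ, α = [a, b, c] →
      (a > c →
        HasBottomCenteredCD (L α) ∧
        SeqBottomInterlacing (rank (L α)) (rankCount (L α))) ∧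
      (a < c →
        HasTopCenteredCD (L α) ∧
        SeqTopInterlacing (rank (L α)) (rankCount (L α))) ∧
      (a = c →
        HasSymmetricCD (L α) ∧
        SeqSymmetric (rank (L α)) (rankCount (L α)))) := by
  refine ⟨fun h => ?_, fun h => ?_, ?_⟩
  · obtain ⟨a, rfl⟩ := List.length_eq_one_iff.mp h
    obtain ⟨h1, h2⟩ := (hasShape_singleton a).symmetric (Or.inr ⟨rfl, rfl⟩)
    exact ⟨h1, fun k hk => (hasShape_singleton a).rankCount_eq_one hk, h2⟩
  · match α, hlen, h with
    | [], _, _ => exact hasShape_nil.bottomCentered le_rfl (Or.inr rfl)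
    | [a, b], _, _ => exact (hasShape_pair a b).bottomCentered (Nat.zero_le a) (Or.inr rfl)
    | [a], _, h => exact absurd h (by simp [Nat.even_iff])
    | [a, b, c], _, h => exact absurd h (by simp [Nat.even_iff])
    | _ :: _ :: _ :: _ :: _, hlen, _ =>
      simp only [List.length_cons] at hlen
      omega
  · rintro a b c rfl
    have hb : 0 < b := hpos b (by simp)
    exact ⟨fun h => (hasShape_triple a b c).bottomCentered h.le (Or.inl hb),
      fun h => (hasShape_triple a b c).topCentered h hb,
      fun h => (hasShape_triple a b c).symmetric (Or.inl ⟨hb, h⟩)⟩
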